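/- **Setting.** Let $(Z,\rho)$ be a compact metric space, let $X\subseteq Z$ be a closed subset with the restricted metric, let $n\ge 0$, and let $\mathbb K$ be $\mathbb C$ or $\mathbb R$. Give $M_n(\mathbb K)$ the operator norm from the inner product space $\mathbb K^n$. Identify $M_n(C(X,\mathbb K))$ with the continuous functions $X\to M_n(\mathbb K)$, with the supremum norm, and similarly for $Z$. Let $\pi$ denote restriction of functions from $Z$ to $X$. A projection is an element $p$ with $p=p^2=p^*$. A path is a norm-continuous function on $[0,1]$. For a function $a$ on a metric space $Y$ with values in a normed space, put $$L(a)=\sup\{\|a(x)-a(y)\|/\rho(x,y): x,y\in Y,\ x\neq y\}\in[0,\infty].$$ Let $\lambda_n$ be the smallest constant (the infimum of the constants) $c\ge 0$ with the following property: for every compact metric space $W$, every closed $V\subseteq W$, every compact space $T$, every constant $M\ge 0$ and every continuous function $F$ from $V\times T$ to the self-adjoint matrices in $M_n(\mathbb C)$ with $L(F(\cdot,t))\le M$ for all $t\in T$, there is a continuous extension $G$ of $F$ to $W\times T$, again with self-adjoint values, such that $L(G(\cdot,t))\le cM$ for all $t\in T$ and $\|G\|_\infty=\|F\|_\infty$.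 (The same $\lambda_n$, defined by complex matrices, is used for both choices of $\mathbb K$.) **Theorem 6.4.** Let $p:[0,1]\to M_n(C(X,\mathbb K))$ be a path of projections, and let $q_0,q_1$ be projections in $M_n(C(Z,\mathbb K))$ with $\pi(q_0)=p_0$ and $\pi(q_1)=p_1$. Let $N\ge 0$ be a constant with $L(p_t)\le N$ for all $t$, and set $N'=\max\{L(q_0),L(q_1)\}$. Let $\varepsilon\ge 0$ and assume that $X$ is $\varepsilon$-dense in $Z$, i.e. every point of $Z$ is within distance $\le\varepsilon$ of some point of $X$. If $$\varepsilon\lambda_nN<\tfrac1{14}\qquad\text{and}\qquad \varepsilon N'<\tfrac12$$ (with the convention $0\cdot\infty=0$), then there is a path $t\mapsto q_t$ of projections in $M_n(C(Z,\mathbb K))$ from $q_0$ to $q_1$ such that, for every $t\in[0,1]$, $\pi(q_t)=p_s$ for some $s\in[0,1]$, and $$L(q_t)\le\left(\tfrac12-\varepsilon N'\right)^{-1}\max\{7\lambda_nN,\,N'\}.$$ -/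

import Mathlib

open scoped NNReal ENNReal
open scoped Matrix.Norms.L2Operator

namespace ProjectionExtension

/-- The Lipschitz seminorm `L(f) = sup { ‖f x - f y‖ / ρ(x, y) : x ≠ y }`, with values
in `[0, ∞]`. -/
noncomputable def lipSeminorm {Y E : Type*} [MetricSpace Y] [SeminormedAddCommGroup E]
    (f : Y → E) : ℝ≥0∞ :=
  ⨆ (x : Y) (y : Y) (_ : x ≠ y), ‖f x - f y‖ₑ / edist x y

/-- The supremum norm `‖f‖_∞`, with values in `[0, ∞]`. -/
noncomputable def supNorm {Y E : Type*} [SeminormedAddCommGroup E] (f : Y → E) : ℝ≥0∞ :=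
  ⨆ x : Y, ‖f x‖ₑ

/-- The real Banach space of self-adjoint complex `n × n` matrices with the operator norm
coming from the Hermitian space `ℂⁿ`. -/
abbrev SAMatrix (n : ℕ) : Type := selfAdjoint (Matrix (Fin n) (Fin n) ℂ)

/-- `c` is a constant for the parametrized, norm-preserving Lipschitz extension problem into the
self-adjoint `n × n` matrices: for all compact metric spaces `Z`, closed `X ⊆ Z` and compact
parameter spaces `T`, every continuous `F` on `X × T` with `L(F_t) ≤ N` for all `t` has a
continuous extension `G` to `Z × T` with `L(G_t) ≤ c N` for all `t` and `‖G‖_∞ = ‖F‖_∞`. -/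
def IsExtensionConstant (n : ℕ) (c : ℝ≥0) : Prop :=
  ∀ (Z : Type) [MetricSpace Z] [CompactSpace Z] (X : Set Z), IsClosed X →
    ∀ (T : Type) [TopologicalSpace T] [CompactSpace T] (F : C(X × T, SAMatrix n)) (N : ℝ≥0),
      (∀ t : T, lipSeminorm (fun x : X => F (x, t)) ≤ N) →
        ∃ G : C(Z × T, SAMatrix n),
          (∀ (x : X) (t : T), G ((x : Z), t) = F (x, t)) ∧
          (∀ t : T, lipSeminorm (fun z : Z => G (z, t)) ≤ c * N) ∧
          supNorm G = supNorm F

/-- The constant `λ_n`: the infimum of all extension constants. -/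
noncomputable def extensionConstant (n : ℕ) : ℝ≥0 :=
  sInf {c : ℝ≥0 | IsExtensionConstant n c}

end ProjectionExtension

namespace ProjectionExtension

/-! Work first with self-adjoint functions, which form a vector space, and return to projections by
functional calculus. A near-optimal extension constant `c` extends the path `p` to a path `g` of
self-adjoint functions on `Z`, each with Lipschitz seminorm at most `c * N`. Since `q₀` and `g 0`
agree on `X`, the segment between them keeps that restriction, and likewise for `g 1` and `q₁`. The
concatenated path joins `q₀` to `q₁` with Lipschitz seminorm at most `K`, where `K` dominates `c *
N` and `N'`.

On `X` these functions are projection-valued, so by `ε`-density every value on `Z` is within `ε * K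
< 1/2` of a projection. Its spectrum therefore keeps distance `γ = 1/2 - ε * K` from `1/2`, and the
spectral projection for `[1/2, ∞)` can be taken pointwise (`exists_isGapProjection`). This map fixes
projections, and it is Lipschitz with constant `γ⁻¹` (`IsGapProjection.mul_norm_sub_le`), thanks to
the sharp Sylvester bound `norm_le_of_sylvester`.

It remains to choose `K`. If `λ_n N < N'`, take `K = N'`; otherwise take `K = 2 λ_n N`, where the
factor 2 leaves room because the infimum `λ_n` need not be attained. -/

/-! ### Perturbation of spectral projections across a gap. -/

theorem exists_norm_apply_eq_opNorm {𝕜 E F : Type*} [RCLike 𝕜] [NormedAddCommGroup E]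
    [NormedSpace 𝕜 E] [FiniteDimensional 𝕜 E] [NormedAddCommGroup F] [NormedSpace 𝕜 F]
    (f : E →L[𝕜] F) : ∃ x : E, ‖x‖ ≤ 1 ∧ ‖f x‖ = ‖f‖ := by
  have : ProperSpace E := FiniteDimensional.proper_rclike 𝕜 E
  obtain ⟨x, hx, hmax⟩ := (isCompact_closedBall (0 : E) 1).exists_isMaxOn
    ⟨0, by simp⟩ (f := fun x => ‖f x‖) (by fun_prop)
  have hx1 : ‖x‖ ≤ 1 := by simpa using hx
  refine ⟨x, hx1, le_antisymm (f.unit_le_opNorm x hx1) ?_⟩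
  refine ContinuousLinearMap.opNorm_le_of_unit_norm (norm_nonneg _) fun y hy => ?_
  exact hmax (by simp [hy])

/-- If `A ≥ γ` on the range of `Y` and `B ≤ -γ` on the range of its adjoint, then the solution `Y`
of the Sylvester equation `A Y - Y B = C` satisfies `2 γ ‖Y‖ ≤ ‖C‖`. -/
theorem norm_le_of_sylvester {𝕜 E : Type*} [RCLike 𝕜] [NormedAddCommGroup E]
    [InnerProductSpace 𝕜 E] [FiniteDimensional 𝕜 E] [CompleteSpace E] {A B Y : E →L[𝕜] E} {γ : ℝ}
    (hA : ∀ v, γ * ‖Y v‖ ^ 2 ≤ RCLike.re (inner 𝕜 (A (Y v)) (Y v)))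
    (hB : ∀ v, RCLike.re (inner 𝕜 (B (Y.adjoint v)) (Y.adjoint v)) ≤ -(γ * ‖Y.adjoint v‖ ^ 2)) :
    2 * γ * ‖Y‖ ≤ ‖A * Y - Y * B‖ := by
  obtain ⟨v, hv1, hv⟩ := exists_norm_apply_eq_opNorm Y
  set s := ‖Y‖ with hs
  rcases (norm_nonneg Y).eq_or_lt with h0 | hpos
  · rw [← hs] at h0
    rw [← h0]; simp
  rw [← hs] at hpos
  set w := Y.adjoint (Y v) with hw
  have hwn : ‖w‖ ≤ s ^ 2 := by
    have := Y.adjoint.le_opNorm (Y v)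
    rw [LinearIsometryEquiv.norm_map, hv, ← hs] at this
    rw [sq]; exact this
  have hinner : inner 𝕜 w v = ((s ^ 2 : ℝ) : 𝕜) := by
    rw [hw, ContinuousLinearMap.adjoint_inner_left, inner_self_eq_norm_sq_to_K, hv]; simp
  -- Equality in Cauchy-Schwarz: a norm-attaining `v` is an eigenvector of `Y* Y`. This turns the
  -- hypothesis on `B` at `w` into one at `v`, so that pairing `(A Y - Y B) v` with `Y v` gives the
  -- bound.
  have hwv : w = ((s ^ 2 : ℝ) : 𝕜) • v := by
    rw [← sub_eq_zero, ← norm_eq_zero, ← sq_eq_zero_iff]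
    apply le_antisymm _ (sq_nonneg _)
    rw [@norm_sub_sq 𝕜, inner_smul_right, hinner, norm_smul, RCLike.norm_ofReal, abs_of_nonneg (sq_nonneg s)]
    rw [← RCLike.ofReal_mul, RCLike.ofReal_re]
    have h1 : ‖w‖ ^ 2 ≤ (s ^ 2) ^ 2 := by gcongr
    have h2 : (s ^ 2 * ‖v‖) ^ 2 ≤ (s ^ 2 * 1) ^ 2 := by gcongr
    nlinarith
  have hv1' : ‖v‖ = 1 := by
    refine le_antisymm hv1 ?_
    have := Y.le_opNorm v
    rw [hv, ← hs] at this
    nlinarith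
  have h1 := hA v
  have h2 := hB (Y v)
  rw [hv] at h1
  rw [← hw] at h2
  have h3 : RCLike.re (inner 𝕜 (B w) w) = s ^ 2 * RCLike.re (inner 𝕜 (Y (B v)) (Y v)) := by
    have : inner 𝕜 (B w) w = ((s ^ 2 : ℝ) : 𝕜) * inner 𝕜 (Y (B v)) (Y v) := by
      rw [← ContinuousLinearMap.adjoint_inner_right Y, ← hw]
      conv_lhs => enter [2]; rw [hwv]
      rw [map_smul, inner_smul_left]
      simp
    rw [this, RCLike.re_ofReal_mul]
  have hwn' : ‖w‖ = s ^ 2 := by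
    rw [hwv, norm_smul, hv1', RCLike.norm_ofReal, abs_of_nonneg (sq_nonneg s), mul_one]
  rw [hwn', h3] at h2
  have h4 : RCLike.re (inner 𝕜 (Y (B v)) (Y v)) ≤ -(γ * s ^ 2) := by
    have : 0 < s ^ 2 := by positivity
    by_contra! hcon
    nlinarith
  have h5 : RCLike.re (inner 𝕜 ((A * Y - Y * B) v) (Y v)) ≤ ‖A * Y - Y * B‖ * s := by
    refine (RCLike.re_le_norm _).trans ((norm_inner_le_norm _ _).trans ?_)
    rw [hv]
    gcongr
    simpa [hv1'] using (A * Y - Y * B).le_opNorm v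
  have h6 : RCLike.re (inner 𝕜 ((A * Y - Y * B) v) (Y v))
      = RCLike.re (inner 𝕜 (A (Y v)) (Y v)) - RCLike.re (inner 𝕜 (Y (B v)) (Y v)) := by
    simp [inner_sub_left]
  rw [h6] at h5
  have : 2 * γ * s * s ≤ ‖A * Y - Y * B‖ * s := by nlinarith
  exact le_of_mul_le_mul_right this hpos

/-- `P` is a projection commuting with `S` such that `S - 1/2 ≥ γ` on the range of `P` and
`S - 1/2 ≤ -γ` on its complement. -/
structure IsGapProjection {𝕜 E : Type*} [RCLike 𝕜] [NormedAddCommGroup E]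
    [InnerProductSpace 𝕜 E] [CompleteSpace E] (γ : ℝ) (S P : E →L[𝕜] E) : Prop where
  proj : IsStarProjection P
  comm : S * P = P * S
  gap : ∀ v, γ * ‖v‖ ^ 2 ≤ RCLike.re (inner 𝕜 ((S - (1 / 2 : 𝕜) • 1) ((2 • P - 1 : E →L[𝕜] E) v)) v)

namespace IsGapProjection

variable {𝕜 E : Type*} [RCLike 𝕜] [NormedAddCommGroup E] [InnerProductSpace 𝕜 E]
  [FiniteDimensional 𝕜 E] [CompleteSpace E] {γ : ℝ} {S T P Q : E →L[𝕜] E}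

/-- `Y = P (1 - Q)` solves a Sylvester equation with right side `P (S - T) (1 - Q)`; the shifted `S`
is at least `γ` on the range of `P`, and the shifted `T` at most `-γ` on that of `1 - Q`. -/
theorem two_mul_norm_mul_one_sub_le (h : IsGapProjection γ S P) (k : IsGapProjection γ T Q) :
    2 * γ * ‖P * (1 - Q)‖ ≤ ‖S - T‖ := by
  have hP := h.proj.isIdempotentElem.eq
  have hQ := k.proj.isIdempotentElem.eq
  have hQ' := k.proj.one_sub
  have hadj : ContinuousLinearMap.adjoint (P * (1 - Q)) = (1 - Q) * P := by
    rw [← ContinuousLinearMap.star_eq_adjoint, star_mul, h.proj.isSelfAdjoint.star_eq,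
      hQ'.isSelfAdjoint.star_eq]
  have key := norm_le_of_sylvester (Y := P * (1 - Q)) (A := S - (1 / 2 : 𝕜) • 1)
    (B := T - (1 / 2 : 𝕜) • 1) (γ := γ) (fun v => ?_) (fun v => ?_)
  · refine key.trans ?_
    have e : (S - (1 / 2 : 𝕜) • 1) * (P * (1 - Q)) - P * (1 - Q) * (T - (1 / 2 : 𝕜) • 1)
        = P * (S - T) * (1 - Q) := by
      have h1 : S * (P * (1 - Q)) = P * S * (1 - Q) := by rw [← mul_assoc, h.comm]
      have h2 : P * (1 - Q) * T = P * T * (1 - Q) := by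
        rw [mul_assoc, mul_assoc, sub_mul, mul_sub T, k.comm, one_mul, mul_one]
      rw [sub_mul, mul_sub _ T, h1, h2, smul_one_mul, mul_smul_one, mul_sub P S T, sub_mul]
      abel
    rw [e]
    calc ‖P * (S - T) * (1 - Q)‖ ≤ ‖P‖ * ‖S - T‖ * ‖1 - Q‖ :=
          (norm_mul_le _ _).trans (by gcongr; exact norm_mul_le _ _)
      _ ≤ 1 * ‖S - T‖ * 1 := by
          gcongr
          · exact h.proj.norm_le
          · exact hQ'.norm_le
      _ = _ := by ring
  · have := h.gap ((P * (1 - Q)) v)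
    have e : (2 • P - 1 : E →L[𝕜] E) ((P * (1 - Q)) v) = (P * (1 - Q)) v := by
      rw [← mul_apply_eq_comp, ← mul_assoc, sub_mul, smul_mul_assoc, hP, one_mul,
        two_smul, add_sub_cancel_right]
    rwa [e] at this
  · rw [hadj]
    have := k.gap (((1 - Q) * P) v)
    have e : (2 • Q - 1 : E →L[𝕜] E) (((1 - Q) * P) v) = - ((1 - Q) * P) v := by
      have : (2 • Q - 1) * ((1 - Q) * P) = - ((1 - Q) * P) := by
        have : Q * (1 - Q) = 0 := by rw [mul_sub, hQ, mul_one, sub_self]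
        rw [← mul_assoc, sub_mul, smul_mul_assoc, this, smul_zero, zero_sub, one_mul, neg_mul]
      rw [← mul_apply_eq_comp, this]; rfl
    rw [e, map_neg, inner_neg_left, map_neg] at this
    linarith

/-- `P - Q` is the difference of two off-diagonal corners, each bounded by `‖S - T‖ / (2γ)`. -/
theorem mul_norm_sub_le (h : IsGapProjection γ S P) (k : IsGapProjection γ T Q) (hγ : 0 ≤ γ) :
    γ * ‖P - Q‖ ≤ ‖S - T‖ := by
  have h1 := h.two_mul_norm_mul_one_sub_le k
  have h2 := k.two_mul_norm_mul_one_sub_le h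
  have e : P - Q = P * (1 - Q) - star (Q * (1 - P)) := by
    rw [star_mul, k.proj.isSelfAdjoint.star_eq, h.proj.one_sub.isSelfAdjoint.star_eq]
    noncomm_ring
  have h3 : ‖P - Q‖ ≤ ‖P * (1 - Q)‖ + ‖Q * (1 - P)‖ := by
    rw [e]
    refine (norm_sub_le _ _).trans_eq ?_
    rw [ContinuousLinearMap.star_eq_adjoint, LinearIsometryEquiv.norm_map]
  rw [norm_sub_rev T S] at h2
  nlinarith [mul_le_mul_of_nonneg_left h3 hγ]

end IsGapProjection

/-- A self-adjoint matrix at distance at most `δ` from a projection has a spectral projection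
with gap `1/2 - δ`. -/
theorem exists_isGapProjection {𝕜 : Type*} [RCLike 𝕜] {n : ℕ} {a p : Matrix (Fin n) (Fin n) 𝕜}
    (ha : IsSelfAdjoint a) (hp : IsStarProjection p) {δ : ℝ} (hap : ‖a - p‖ ≤ δ) :
    ∃ P : Matrix (Fin n) (Fin n) 𝕜, IsStarProjection P ∧
      IsGapProjection (1 / 2 - δ) (Matrix.toEuclideanCLM (𝕜 := 𝕜) a)
        (Matrix.toEuclideanCLM (𝕜 := 𝕜) P) := by
  have hfin : (spectrum ℝ a).Finite := Matrix.finite_real_spectrum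
  have hc : ∀ f : ℝ → ℝ, ContinuousOn f (spectrum ℝ a) := fun f => hfin.continuousOn f
  have hspec : ∀ μ ∈ spectrum ℝ a, 1 / 2 - δ ≤ |μ - 1 / 2| := by
    intro μ hμ
    have hH : a.IsHermitian := ha
    rw [hH.spectrum_real_eq_range_eigenvalues] at hμ
    obtain ⟨i, rfl⟩ := hμ
    set μ := hH.eigenvalues i
    set v := hH.eigenvectorBasis i
    set T := Matrix.toEuclideanCLM (𝕜 := 𝕜) p
    have hv : ‖v‖ = 1 := hH.eigenvectorBasis.norm_eq_one i
    have hav : Matrix.toEuclideanCLM (𝕜 := 𝕜) a v = (μ : 𝕜) • v := by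
      have := hH.mulVec_eigenvectorBasis i
      ext j
      have := congrFun this j
      rw [Matrix.ofLp_toEuclideanCLM, this]
      simp [μ, v, RCLike.real_smul_eq_coe_mul]
    have hT : IsStarProjection T := hp.map _
    have h1 : ‖(μ : 𝕜) • v - T v‖ ≤ δ := by
      have := (Matrix.toEuclideanCLM (𝕜 := 𝕜) (a - p)).le_opNorm v
      rw [map_sub, sub_apply, hav, hv, mul_one, ← map_sub, ← Matrix.cstar_norm_def] at this
      exact this.trans hap
    -- `T - 1/2` is half a reflection, so an eigenvalue within `δ` of `1/2 ± 1/2` is forced by the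
    -- triangle inequality below, at least as far as its distance from `1/2` is concerned.
    have h2 : ‖T v - (1 / 2 : 𝕜) • v‖ = 1 / 2 := by
      have h3 : RCLike.re (inner 𝕜 (T v) v) = ‖T v‖ ^ 2 := by
        have h4 : T (T v) = T v := by
          rw [← mul_apply_eq_comp, hT.isIdempotentElem.eq]
        rw [← inner_self_eq_norm_sq (𝕜 := 𝕜), ← ContinuousLinearMap.adjoint_inner_left,
          ← ContinuousLinearMap.star_eq_adjoint, hT.isSelfAdjoint.star_eq, h4]
      have h5 : (1 / 2 : 𝕜) = ((1 / 2 : ℝ) : 𝕜) := by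
        rw [RCLike.ofReal_div, RCLike.ofReal_one, RCLike.ofReal_ofNat]
      rw [← sq_eq_sq₀ (norm_nonneg _) (by norm_num), @norm_sub_sq 𝕜, inner_smul_right, h5,
        RCLike.re_ofReal_mul, h3, norm_smul, hv, RCLike.norm_ofReal]
      rw [abs_of_nonneg (by norm_num)]
      ring
    have h3 : T v - (1 / 2 : 𝕜) • v = -((μ : 𝕜) • v - T v) + ((μ - 1 / 2 : ℝ) : 𝕜) • v := by
      push_cast
      rw [sub_smul]
      abel
    rw [h3] at h2
    have h4 := norm_add_le (-((μ : 𝕜) • v - T v)) (((μ - 1 / 2 : ℝ) : 𝕜) • v)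
    rw [h2, norm_neg, norm_smul, hv, RCLike.norm_ofReal] at h4
    linarith
  set χ : ℝ → ℝ := fun x => if 1 / 2 ≤ x then 1 else 0 with hχ
  -- Chosen so that `(x - 1/2)(2 χ x - 1) = |x - 1/2| = (1/2 - δ) + r x ^ 2` on the spectrum: the
  -- gap inequality then follows from positivity of a square. Continuity of `χ` is no issue, the
  -- spectrum being finite.
  set r : ℝ → ℝ := fun x => Real.sqrt (|x - 1 / 2| - (1 / 2 - δ)) with hr
  have hP : IsStarProjection (cfc χ a) := by
    refine ⟨?_, cfc_predicate χ a⟩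
    rw [IsIdempotentElem, ← cfc_mul χ χ a (hc _) (hc _)]
    congr 1
    ext x; simp [hχ]
  refine ⟨cfc χ a, hP, hP.map _, ?_, fun v => ?_⟩
  · rw [← map_mul, ← map_mul]
    congr 1
    exact (cfc_commute_cfc id χ a).eq |> fun h => by rwa [cfc_id ℝ a] at h
  · have hb : IsSelfAdjoint (cfc r a) := cfc_predicate r a
    have e : (a - algebraMap ℝ _ (1 / 2)) * (2 • cfc χ a - 1)
        = algebraMap ℝ _ (1 / 2 - δ) + cfc r a * cfc r a := by
      have e1 : a - algebraMap ℝ _ (1 / 2) = cfc (fun x : ℝ => x - 1 / 2) a := by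
        rw [cfc_sub _ _ a (hc _) (hc _), cfc_const _ a, cfc_id' ℝ a]
      have e2 : 2 • cfc χ a - 1 = cfc (fun x : ℝ => 2 • χ x - 1) a := by
        rw [cfc_sub _ _ a (hc _) (hc _), cfc_const_one ℝ a, cfc_smul _ _ a (hc _)]
      have e3 : algebraMap ℝ _ (1 / 2 - δ) = cfc (fun x : ℝ => 1 / 2 - δ) a := by
        rw [cfc_const _ a]
      rw [e1, e2, e3, ← cfc_mul _ _ a (hc _) (hc _), ← cfc_mul _ _ a (hc _) (hc _),
        ← cfc_add a _ _ (hc _) (hc _)]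
      refine cfc_congr fun x hx => ?_
      have := hspec x hx
      simp only [hr, hχ]
      rw [Real.mul_self_sqrt (by linarith)]
      split_ifs with h
      · rw [abs_of_nonneg (by linarith)]; simp; ring
      · rw [abs_of_neg (by linarith)]; simp
    have e' := congrArg (Matrix.toEuclideanCLM (𝕜 := 𝕜)) e
    have hal : ∀ c : ℝ, algebraMap ℝ (Matrix (Fin n) (Fin n) 𝕜) c = (c : 𝕜) • 1 := fun c => by
      rw [Algebra.algebraMap_eq_smul_one, RCLike.real_smul_eq_coe_smul (K := 𝕜)]
    rw [hal, hal] at e'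
    generalize 1 / 2 - δ = γ at e' ⊢
    simp only [map_mul, map_add, map_sub, map_smul, map_one, map_nsmul] at e'
    set B := Matrix.toEuclideanCLM (𝕜 := 𝕜) (cfc r a)
    have hB : IsSelfAdjoint B := hb.map _
    have h5 : (1 / 2 : 𝕜) = ((1 / 2 : ℝ) : 𝕜) := by
        rw [RCLike.ofReal_div, RCLike.ofReal_one, RCLike.ofReal_ofNat]
    rw [h5, ← mul_apply_eq_comp, e', add_apply, inner_add_left, map_add]
    have h6 : RCLike.re (inner 𝕜 ((B * B) v) v) = ‖B v‖ ^ 2 := by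
      rw [← inner_self_eq_norm_sq (𝕜 := 𝕜), ← ContinuousLinearMap.adjoint_inner_left,
          ← ContinuousLinearMap.star_eq_adjoint, hB.star_eq, mul_apply_eq_comp]
    rw [h6, smul_apply, one_apply_eq_self, inner_smul_left, RCLike.conj_ofReal,
      RCLike.re_ofReal_mul, inner_self_eq_norm_sq]
    nlinarith [sq_nonneg ‖B v‖]

theorem lipSeminorm_le_iff {Y E : Type*} [MetricSpace Y] [SeminormedAddCommGroup E] {f : Y → E}
    {K : ℝ≥0∞} : lipSeminorm f ≤ K ↔ ∀ x y, ‖f x - f y‖ₑ ≤ K * edist x y := by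
  simp only [lipSeminorm, iSup_le_iff]
  refine forall₂_congr fun x y => ?_
  by_cases h : x = y
  · simp [h, ← ofReal_norm]
  · simp only [ne_eq, h, not_false_eq_true, forall_true_left]
    exact ENNReal.div_le_iff (edist_pos.2 h).ne' (edist_ne_top x y)

theorem lipSeminorm_le_coe_iff {Y E : Type*} [MetricSpace Y] [SeminormedAddCommGroup E] {f : Y → E}
    {K : ℝ≥0} : lipSeminorm f ≤ K ↔ ∀ x y, ‖f x - f y‖ ≤ K * dist x y := by
  rw [lipSeminorm_le_iff]
  refine forall₂_congr fun x y => ?_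
  rw [← ofReal_norm, edist_dist, ← ENNReal.ofReal_coe_nnreal,
    ← ENNReal.ofReal_mul K.coe_nonneg, ENNReal.ofReal_le_ofReal_iff (by positivity)]

/-! ### Existence and lower bound of the extension constants. -/

section McShane

variable {Z : Type*} [MetricSpace Z] {X : Set Z} [CompactSpace X]

/-- The largest `K`-Lipschitz function on `Z` that is below `f` on `X`. -/
noncomputable def mcShane (K : ℝ) (f : C(X, ℝ)) (z : Z) : ℝ := ⨅ x : X, (f x + K * dist z x)

theorem mcShane_bddBelow {K : ℝ} (hK : 0 ≤ K) (f : C(X, ℝ)) (z : Z) :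
    BddBelow (Set.range fun x : X => f x + K * dist z x) := by
  refine ⟨-‖f‖, ?_⟩
  rintro _ ⟨x, rfl⟩
  have h := (abs_le.1 (f.norm_coe_le_norm x)).1
  have : 0 ≤ K * dist z x := by positivity
  simp only
  linarith

/-- Varying the function and the point together yields the Lipschitz bound in `z` and continuity in
the parameter at once. -/
theorem mcShane_le_add [Nonempty X] {K : ℝ} (hK : 0 ≤ K) (f g : C(X, ℝ)) (z w : Z) :
    mcShane K f z ≤ mcShane K g w + (dist f g + K * dist z w) := by
  rw [← sub_le_iff_le_add]
  refine le_ciInf fun x => ?_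
  rw [sub_le_iff_le_add]
  refine (ciInf_le (mcShane_bddBelow hK f z) x).trans ?_
  have h1 := (le_abs_self _).trans (ContinuousMap.dist_apply_le_dist (f := f) (g := g) x)
  have h2 := mul_le_mul_of_nonneg_left (dist_triangle z w x) hK
  linarith

theorem abs_mcShane_sub_le [Nonempty X] {K : ℝ} (hK : 0 ≤ K) (f g : C(X, ℝ)) (z w : Z) :
    |mcShane K f z - mcShane K g w| ≤ dist f g + K * dist z w := by
  rw [abs_sub_le_iff]
  have h1 := mcShane_le_add hK f g z w
  have h2 := mcShane_le_add hK g f w z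
  rw [dist_comm g f, dist_comm w z] at h2
  constructor <;> linarith

theorem continuous_mcShane [Nonempty X] {K : ℝ} (hK : 0 ≤ K) :
    Continuous fun q : C(X, ℝ) × Z => mcShane K q.1 q.2 := by
  refine (LipschitzWith.of_dist_le_mul (K := 1 + K.toNNReal) fun q r => ?_).continuous
  rw [Real.dist_eq]
  refine (abs_mcShane_sub_le hK _ _ _ _).trans ?_
  have h1 : dist q.1 r.1 ≤ dist q r := le_max_left _ _
  have h2 : dist q.2 r.2 ≤ dist q r := le_max_right _ _
  push_cast
  rw [Real.coe_toNNReal K hK, add_mul, one_mul]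
  gcongr

theorem mcShane_eq [Nonempty X] {K : ℝ} (hK : 0 ≤ K) (f : C(X, ℝ))
    (hf : ∀ x y, |f x - f y| ≤ K * dist x y) (x : X) : mcShane K f x = f x := by
  refine le_antisymm ?_ (le_ciInf fun y => ?_)
  · exact (ciInf_le (mcShane_bddBelow hK f x) x).trans_eq (by simp)
  · have := (le_abs_self _).trans (hf x y)
    rw [Subtype.dist_eq] at this
    linarith

end McShane

section Retraction

variable {E : Type*} [NormedAddCommGroup E] [NormedSpace ℝ E]

/-- The radial retraction of a normed space onto the closed ball of radius `R > 0`. -/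
noncomputable def radialRetraction (R : ℝ) (v : E) : E := (R / max R ‖v‖) • v

theorem norm_radialRetraction_le {R : ℝ} (hR : 0 < R) (v : E) : ‖radialRetraction R v‖ ≤ R := by
  have h : 0 < max R ‖v‖ := lt_max_of_lt_left hR
  rw [radialRetraction, norm_smul, Real.norm_of_nonneg (by positivity), div_mul_eq_mul_div,
    div_le_iff₀ h]
  gcongr
  exact le_max_right _ _

theorem radialRetraction_of_norm_le {R : ℝ} (hR : 0 < R) {v : E} (hv : ‖v‖ ≤ R) :
    radialRetraction R v = v := by
  rw [radialRetraction, max_eq_left hv, div_self hR.ne', one_smul]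

/-- Moving the vector and changing the scaling factor each cost at most `‖v - w‖`. -/
theorem norm_radialRetraction_sub_le {R : ℝ} (hR : 0 < R) (v w : E) :
    ‖radialRetraction R v - radialRetraction R w‖ ≤ 2 * ‖v - w‖ := by
  simp only [radialRetraction]
  have hv : 0 < max R ‖v‖ := lt_max_of_lt_left hR
  have hw : 0 < max R ‖w‖ := lt_max_of_lt_left hR
  set a := max R ‖v‖
  set b := max R ‖w‖
  have hRa : R / a ≤ 1 := (div_le_one hv).2 (le_max_left _ _)
  have hwb : ‖w‖ / b ≤ 1 := (div_le_one hw).2 (le_max_right _ _)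
  have hab : |b - a| ≤ ‖v - w‖ := by
    rw [norm_sub_rev]
    refine (abs_max_sub_max_le_max R ‖w‖ R ‖v‖).trans ?_
    rw [sub_self, abs_zero]
    exact max_le (norm_nonneg _) (abs_norm_sub_norm_le _ _)
  have e : (R / a) • v - (R / b) • w = (R / a) • (v - w) + (R / a - R / b) • w := by
    rw [smul_sub, sub_smul]; abel
  have h2 : ‖(R / a - R / b) • w‖ ≤ ‖v - w‖ := by
    have : R / a - R / b = R / a * ((b - a) / b) := by field_simp
    rw [this, norm_smul, norm_mul, Real.norm_of_nonneg (by positivity : 0 ≤ R / a), norm_div,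
      Real.norm_of_nonneg hw.le, Real.norm_eq_abs]
    calc R / a * (|b - a| / b) * ‖w‖ = R / a * |b - a| * (‖w‖ / b) := by ring
      _ ≤ 1 * ‖v - w‖ * 1 := by gcongr
      _ = _ := by ring
  have h1 : ‖(R / a) • (v - w)‖ ≤ ‖v - w‖ := by
    rw [norm_smul, Real.norm_of_nonneg (by positivity)]
    exact mul_le_of_le_one_left (norm_nonneg _) hRa
  rw [e]
  linarith [norm_add_le ((R / a) • (v - w)) ((R / a - R / b) • w)]

theorem continuous_radialRetraction {R : ℝ} (hR : 0 < R) :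
    Continuous (radialRetraction R : E → E) := by
  refine (LipschitzWith.of_dist_le_mul (K := 2) fun v w => ?_).continuous
  rw [dist_eq_norm, dist_eq_norm]
  exact norm_radialRetraction_sub_le hR v w

end Retraction

/-- Parametrized Lipschitz extension into a finite-dimensional space, without norm control. -/
theorem exists_lipschitz_extension {E : Type*} [NormedAddCommGroup E] [NormedSpace ℝ E] {m : ℕ}
    (e : E ≃L[ℝ] (Fin m → ℝ)) {Z T : Type*} [MetricSpace Z] [TopologicalSpace T] {X : Set Z}
    [CompactSpace X] [Nonempty X] (F : C(X × T, E)) (N : ℝ≥0)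
    (hF : ∀ t x y, ‖F (x, t) - F (y, t)‖ ≤ N * dist x y) :
    ∃ G : C(Z × T, E), (∀ (x : X) (t : T), G ((x : Z), t) = F (x, t)) ∧
      ∀ t z w, ‖G (z, t) - G (w, t)‖ ≤
        ‖(e.symm : (Fin m → ℝ) →L[ℝ] E)‖ * (‖(e : E →L[ℝ] (Fin m → ℝ))‖ * N * dist z w) := by
  set K : ℝ := ‖(e : E →L[ℝ] (Fin m → ℝ))‖ * N with hK
  have hK0 : 0 ≤ K := by positivity
  let f : Fin m → C(T, C(X, ℝ)) := fun i =>
    ContinuousMap.curry ⟨fun q : T × X => e (F (q.2, q.1)) i, by fun_prop⟩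
  have hf : ∀ i t x, f i t x = e (F (x, t)) i := fun i t x => rfl
  refine ⟨⟨fun q => e.symm fun i => mcShane K (f i q.2) q.1, ?_⟩, fun x t => ?_, fun t z w => ?_⟩
  · refine e.symm.continuous.comp (continuous_pi fun i => ?_)
    exact (continuous_mcShane hK0).comp (by fun_prop : Continuous fun q : Z × T => (f i q.2, q.1))
  · simp only [ContinuousMap.coe_mk]
    rw [e.symm_apply_eq]
    ext i
    rw [mcShane_eq hK0, hf]
    intro y z
    rw [hf, hf, ← Pi.sub_apply, ← map_sub, ← Real.norm_eq_abs]
    refine (norm_le_pi_norm _ i).trans (((e : E →L[ℝ] (Fin m → ℝ)).le_opNorm _).trans ?_)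
    rw [hK, mul_assoc]
    gcongr
    exact hF t y z
  · simp only [ContinuousMap.coe_mk]
    rw [← map_sub]
    refine ((e.symm : (Fin m → ℝ) →L[ℝ] E).le_opNorm _).trans ?_
    gcongr
    refine (pi_norm_le_iff_of_nonneg (by positivity)).2 fun i => ?_
    simpa using abs_mcShane_sub_le hK0 (f i t) (f i t) z w

instance (n : ℕ) : FiniteDimensional ℝ (SAMatrix n) :=
  FiniteDimensional.of_injective
    ({ toFun := fun a => (a : Matrix (Fin n) (Fin n) ℂ)
       map_add' := fun _ _ => rfl
       map_smul' := fun _ _ => rfl } : SAMatrix n →ₗ[ℝ] Matrix (Fin n) (Fin n) ℂ)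
    Subtype.val_injective

/-- Extend each real coordinate by McShane's formula, then retract radially to restore the supremum
norm. Nonemptiness makes the infimum `extensionConstant` meaningful, since `sInf ∅ = 0`. -/
theorem exists_isExtensionConstant (n : ℕ) : ∃ c, IsExtensionConstant n c := by
  let e : SAMatrix n ≃L[ℝ] (Fin (Module.finrank ℝ (SAMatrix n)) → ℝ) :=
    (Module.finBasis ℝ (SAMatrix n)).equivFunL
  refine ⟨2 * (‖(e.symm : (Fin (Module.finrank ℝ (SAMatrix n)) → ℝ) →L[ℝ] SAMatrix n)‖₊ *
    ‖(e : SAMatrix n →L[ℝ] (Fin (Module.finrank ℝ (SAMatrix n)) → ℝ))‖₊), ?_⟩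
  intro Z _ _ X hX T _ _ F N hF
  have : CompactSpace X := isCompact_iff_compactSpace.1 hX.isCompact
  have hsup : supNorm F = ‖F‖ₑ := by
    refine le_antisymm (iSup_le fun q => ?_) ?_
    · rw [enorm_le_iff_norm_le]; exact F.norm_coe_le_norm q
    · have hfin : supNorm F ≠ ⊤ := ne_top_of_le_ne_top (enorm_ne_top (x := F))
        (iSup_le fun q => by rw [enorm_le_iff_norm_le]; exact F.norm_coe_le_norm q)
      rw [← ofReal_norm, ENNReal.ofReal_le_iff_le_toReal hfin,
        F.norm_le ENNReal.toReal_nonneg]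
      intro q
      rw [← toReal_enorm]
      exact ENNReal.toReal_mono hfin (le_iSup (fun q => ‖F q‖ₑ) q)
  -- The retraction needs a positive radius; the case `F = 0` also absorbs empty `X`.
  rcases (norm_nonneg F).eq_or_lt with h0 | hR
  · have hF0 : F = 0 := norm_eq_zero.1 h0.symm
    subst hF0
    refine ⟨0, fun _ _ => rfl, fun t => ?_, ?_⟩
    · rw [lipSeminorm_le_iff]; simp [← ofReal_norm]
    · simp [supNorm, ← ofReal_norm]
  · have : Nonempty X := by
      by_contra h
      rw [not_nonempty_iff] at h
      exact hR.ne' (by rw [Subsingleton.elim F 0, norm_zero])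
    obtain ⟨G, hGF, hG⟩ := exists_lipschitz_extension e F N
      fun t x y => lipSeminorm_le_coe_iff.1 (hF t) x y
    refine ⟨⟨fun q => radialRetraction ‖F‖ (G q), (continuous_radialRetraction hR).comp G.continuous⟩,
      fun x t => ?_, fun t => ?_, le_antisymm ?_ ?_⟩
    · simp only [ContinuousMap.coe_mk]
      rw [hGF, radialRetraction_of_norm_le hR (F.norm_coe_le_norm _)]
    · rw [← ENNReal.coe_mul, lipSeminorm_le_coe_iff]
      intro z w
      refine (norm_radialRetraction_sub_le hR _ _).trans ?_
      refine (mul_le_mul_of_nonneg_left (hG t z w) two_pos.le).trans_eq ?_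
      push_cast
      ring
    · rw [hsup]
      refine iSup_le fun q => ?_
      rw [enorm_le_iff_norm_le]
      exact norm_radialRetraction_le hR _
    · refine iSup_le fun q => ?_
      refine le_iSup_of_le ((q.1 : Z), q.2) ?_
      simp only [ContinuousMap.coe_mk]
      rw [hGF, radialRetraction_of_norm_le hR (F.norm_coe_le_norm _)]

/-- Test on `F s = s • 1` over the unit interval, with nothing to extend. -/
theorem IsExtensionConstant.one_le {n : ℕ} (hn : n ≠ 0) {c : ℝ≥0} (hc : IsExtensionConstant n c) :
    1 ≤ c := by
  have : NeZero n := ⟨hn⟩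
  have h1 : ‖(1 : SAMatrix n)‖ = 1 := CStarRing.norm_one (E := Matrix (Fin n) (Fin n) ℂ)
  obtain ⟨G, hGF, hG, -⟩ := hc unitInterval Set.univ isClosed_univ Unit
    ⟨fun q => ((q.1 : unitInterval) : ℝ) • (1 : SAMatrix n), by fun_prop⟩ 1 fun t => by
      rw [lipSeminorm_le_coe_iff]
      intro x y
      simp only [ContinuousMap.coe_mk]
      rw [← sub_smul, norm_smul, h1, mul_one, NNReal.coe_one, one_mul]
      rfl
  have h2 := hG ()
  rw [ENNReal.coe_one, mul_one, lipSeminorm_le_coe_iff] at h2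
  have h3 := h2 1 0
  have e : ∀ z : unitInterval, G (z, ()) = (z : ℝ) • (1 : SAMatrix n) :=
    fun z => hGF ⟨z, trivial⟩ ()
  rw [e, e, ← sub_smul, norm_smul, h1, Subtype.dist_eq] at h3
  simpa using h3

theorem one_le_extensionConstant {n : ℕ} (hn : n ≠ 0) : 1 ≤ extensionConstant n :=
  le_csInf (exists_isExtensionConstant n) fun _ hc => IsExtensionConstant.one_le hn hc

/-! ### Transfer between complex and general scalars. -/

section ChangeOfScalars

variable {𝕜 : Type*} [RCLike 𝕜]

theorem map_map_complex (z : 𝕜) : RCLike.map ℂ 𝕜 (RCLike.map 𝕜 ℂ z) = z := by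
  simp [RCLike.re_add_im]

theorem im_I_sq_cases : RCLike.im (RCLike.I : 𝕜) = 0 ∧ (RCLike.I : 𝕜) = 0 ∨
    RCLike.im (RCLike.I : 𝕜) = 1 ∧ (RCLike.I : 𝕜) * RCLike.I = -1 := by
  rcases RCLike.I_eq_zero_or_im_I_eq_one (K := 𝕜) with h | h
  · left; simp [h]
  · right
    refine ⟨h, RCLike.I_mul_I_of_nonzero fun h0 => ?_⟩
    simp [h0] at h

theorem map_mul_map_complex (w : ℂ) (u : 𝕜) :
    RCLike.map ℂ 𝕜 (w * RCLike.map 𝕜 ℂ u) = RCLike.map ℂ 𝕜 w * u := by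
  rcases im_I_sq_cases (𝕜 := 𝕜) with ⟨-, h⟩ | ⟨-, h⟩
  · have hu : (RCLike.re u : 𝕜) = u := by
      conv_rhs => rw [← RCLike.re_add_im u]
      simp [h]
    have hu' : RCLike.im u = 0 := by rw [← hu, RCLike.ofReal_im]
    simp [h, hu, hu']
  · have hu := RCLike.re_add_im u
    simp
    linear_combination ((w.re : 𝕜) + (w.im : 𝕜) * RCLike.I) * hu
      - ((w.im : 𝕜) * (RCLike.im u : 𝕜)) * h

theorem norm_sq_map_of_complex (w : ℂ) : ‖RCLike.map ℂ 𝕜 w‖ ^ 2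
    = w.re ^ 2 + w.im ^ 2 * RCLike.im (RCLike.I : 𝕜) ^ 2 := by
  rw [RCLike.norm_sq_eq_def]
  simp
  ring

theorem norm_map_of_complex_le (w : ℂ) : ‖RCLike.map ℂ 𝕜 w‖ ≤ ‖w‖ := by
  rw [← sq_le_sq₀ (norm_nonneg _) (norm_nonneg _), norm_sq_map_of_complex, Complex.sq_norm,
    Complex.normSq_apply]
  rcases im_I_sq_cases (𝕜 := 𝕜) with ⟨h, -⟩ | ⟨h, -⟩ <;> rw [h] <;> nlinarith [sq_nonneg w.im]

theorem norm_map_complex (u : 𝕜) : ‖RCLike.map 𝕜 ℂ u‖ = ‖u‖ := by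
  rw [← sq_eq_sq₀ (norm_nonneg _) (norm_nonneg _), RCLike.norm_sq_eq_def (z := u), Complex.sq_norm,
    Complex.normSq_apply]
  simp

/-- The factor is 1 for real scalars, where the map is the real part, and 2 for complex ones. -/
theorem norm_sq_map_add (w : ℂ) :
    ‖RCLike.map ℂ 𝕜 w‖ ^ 2 + ‖RCLike.map ℂ 𝕜 (Complex.I * w)‖ ^ 2
      = (1 + RCLike.im (RCLike.I : 𝕜) ^ 2) * ‖w‖ ^ 2 := by
  rw [norm_sq_map_of_complex, norm_sq_map_of_complex, Complex.sq_norm, Complex.normSq_apply]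
  simp
  ring

variable {n : ℕ}

theorem l2_opNorm_le_of_mulVec {A : Matrix (Fin n) (Fin n) 𝕜} {C : ℝ} (hC : 0 ≤ C)
    (h : ∀ x : Fin n → 𝕜, ∑ i, ‖(A.mulVec x) i‖ ^ 2 ≤ C ^ 2 * ∑ i, ‖x i‖ ^ 2) : ‖A‖ ≤ C := by
  rw [Matrix.cstar_norm_def]
  refine ContinuousLinearMap.opNorm_le_bound _ hC fun x => ?_
  rw [← sq_le_sq₀ (norm_nonneg _) (by positivity), mul_pow, EuclideanSpace.norm_sq_eq,
    EuclideanSpace.norm_sq_eq, Matrix.ofLp_toEuclideanCLM]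
  exact h x.ofLp

theorem sum_norm_sq_mulVec_le (A : Matrix (Fin n) (Fin n) 𝕜) (x : Fin n → 𝕜) :
    ∑ i, ‖(A.mulVec x) i‖ ^ 2 ≤ ‖A‖ ^ 2 * ∑ i, ‖x i‖ ^ 2 := by
  have h := pow_le_pow_left₀ (norm_nonneg _) (Matrix.l2_opNorm_mulVec A (WithLp.toLp 2 x)) 2
  rw [mul_pow, EuclideanSpace.norm_sq_eq, EuclideanSpace.norm_sq_eq] at h
  exact h

theorem l2_opNorm_map_of_complex_le (A : Matrix (Fin n) (Fin n) ℂ) :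
    ‖A.map (RCLike.map ℂ 𝕜)‖ ≤ ‖A‖ := by
  refine l2_opNorm_le_of_mulVec (norm_nonneg _) fun x => ?_
  have e : ∀ i, ((A.map (RCLike.map ℂ 𝕜)).mulVec x) i
      = RCLike.map ℂ 𝕜 ((A.mulVec fun j => RCLike.map 𝕜 ℂ (x j)) i) := fun i => by
    simp only [Matrix.mulVec, dotProduct, map_sum, map_mul_map_complex, Matrix.map_apply]
  calc ∑ i, ‖((A.map (RCLike.map ℂ 𝕜)).mulVec x) i‖ ^ 2
      ≤ ∑ i, ‖(A.mulVec fun j => RCLike.map 𝕜 ℂ (x j)) i‖ ^ 2 := by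
        gcongr with i
        rw [e]
        exact norm_map_of_complex_le _
    _ ≤ _ := by
        refine (sum_norm_sq_mulVec_le A _).trans_eq ?_
        simp only [norm_map_complex]

/-- Apply `A` to the `𝕜`-parts of `w` and of `i w` separately and add, using `norm_sq_map_add`. -/
theorem l2_opNorm_map_complex_le (A : Matrix (Fin n) (Fin n) 𝕜) :
    ‖A.map (RCLike.map 𝕜 ℂ)‖ ≤ ‖A‖ := by
  refine l2_opNorm_le_of_mulVec (norm_nonneg _) fun w => ?_
  have e : ∀ (w : Fin n → ℂ) i, RCLike.map ℂ 𝕜 (((A.map (RCLike.map 𝕜 ℂ)).mulVec w) i)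
      = (A.mulVec fun j => RCLike.map ℂ 𝕜 (w j)) i := fun w i => by
    simp only [Matrix.mulVec, dotProduct, map_sum, Matrix.map_apply]
    refine Finset.sum_congr rfl fun j _ => ?_
    rw [mul_comm, map_mul_map_complex, mul_comm]
  have e' : ∀ i, Complex.I * ((A.map (RCLike.map 𝕜 ℂ)).mulVec w) i
      = ((A.map (RCLike.map 𝕜 ℂ)).mulVec fun j => Complex.I * w j) i := fun i => by
    simp only [Matrix.mulVec, dotProduct, Finset.mul_sum]
    exact Finset.sum_congr rfl fun j _ => by ring
  have hκ : 0 < 1 + RCLike.im (RCLike.I : 𝕜) ^ 2 := by positivity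
  refine le_of_mul_le_mul_left ?_ hκ
  calc (1 + RCLike.im (RCLike.I : 𝕜) ^ 2) * ∑ i, ‖((A.map (RCLike.map 𝕜 ℂ)).mulVec w) i‖ ^ 2
      = ∑ i, ‖(A.mulVec fun j => RCLike.map ℂ 𝕜 (w j)) i‖ ^ 2
        + ∑ i, ‖(A.mulVec fun j => RCLike.map ℂ 𝕜 (Complex.I * w j)) i‖ ^ 2 := by
        rw [Finset.mul_sum, ← Finset.sum_add_distrib]
        refine Finset.sum_congr rfl fun i _ => ?_
        rw [← norm_sq_map_add, e', e, e]
    _ ≤ ‖A‖ ^ 2 * ∑ i, ‖RCLike.map ℂ 𝕜 (w i)‖ ^ 2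
        + ‖A‖ ^ 2 * ∑ i, ‖RCLike.map ℂ 𝕜 (Complex.I * w i)‖ ^ 2 :=
        add_le_add (sum_norm_sq_mulVec_le A _) (sum_norm_sq_mulVec_le A _)
    _ = _ := by
        rw [← mul_add, ← Finset.sum_add_distrib]
        simp only [norm_sq_map_add]
        rw [← Finset.mul_sum]
        ring

theorem isSelfAdjoint_map {𝕂 : Type*} [RCLike 𝕂] {A : Matrix (Fin n) (Fin n) 𝕜}
    (hA : IsSelfAdjoint A) : IsSelfAdjoint (A.map (RCLike.map 𝕜 𝕂)) := by
  have h : ∀ i j, star (A j i) = A i j := fun i j => congrFun (congrFun hA i) j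
  ext i j
  rw [Matrix.star_apply, Matrix.map_apply, Matrix.map_apply, ← h i j]
  simp

end ChangeOfScalars

/-- The extension property, over an arbitrary scalar field and for metric spaces in any universe. -/
theorem IsExtensionConstant.exists_extension {n : ℕ} {c : ℝ≥0} (hc : IsExtensionConstant n c)
    {𝕜 : Type*} [RCLike 𝕜] {Z : Type*} [MetricSpace Z] [CompactSpace Z] {X : Set Z}
    (hX : IsClosed X) {T : Type} [TopologicalSpace T] [CompactSpace T]
    (F : C(X × T, Matrix (Fin n) (Fin n) 𝕜)) (hFs : ∀ q, IsSelfAdjoint (F q)) {N : ℝ≥0}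
    (hF : ∀ t x y, ‖F (x, t) - F (y, t)‖ ≤ N * dist x y) :
    ∃ G : C(Z × T, Matrix (Fin n) (Fin n) 𝕜), (∀ (x : X) (t : T), G ((x : Z), t) = F (x, t)) ∧
      (∀ q, IsSelfAdjoint (G q)) ∧ ∀ t z w, ‖G (z, t) - G (w, t)‖ ≤ c * N * dist z w := by
  -- The Kuratowski embedding provides an isometric copy of `Z` in `Type`, where
  -- `IsExtensionConstant` applies.
  let φ := (kuratowskiEmbedding.isometry Z).isometryEquivOnRange
  have : CompactSpace (Set.range (kuratowskiEmbedding Z)) := φ.toHomeomorph.compactSpace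
  let X' : Set (Set.range (kuratowskiEmbedding Z)) := φ.symm ⁻¹' X
  have hX' : IsClosed X' := hX.preimage φ.symm.continuous
  let j : X' → X := fun x => ⟨φ.symm x, x.2⟩
  have hj : Continuous j := by
    refine Continuous.subtype_mk (φ.symm.continuous.comp continuous_subtype_val) _
  have hjd : ∀ x y, dist (j x) (j y) = dist x y := fun x y => φ.symm.isometry.dist_eq _ _
  obtain ⟨G, hGF, hG, -⟩ := hc (Set.range (kuratowskiEmbedding Z)) X' hX' T
    ⟨fun q => ⟨(F (j q.1, q.2)).map (RCLike.map 𝕜 ℂ), isSelfAdjoint_map (hFs _)⟩, by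
      refine Continuous.subtype_mk ?_ _
      exact (F.continuous.comp (by fun_prop : Continuous fun q : X' × T => (j q.1, q.2))).matrix_map
        (RCLike.map 𝕜 ℂ).continuous⟩ N fun t => by
      rw [lipSeminorm_le_coe_iff]
      intro x y
      refine le_trans ?_ ((hF t (j x) (j y)).trans_eq (by rw [hjd]))
      refine le_trans (le_of_eq ?_) (l2_opNorm_map_complex_le _)
      rw [Matrix.map_sub _ (map_sub _)]
      rfl
  refine ⟨⟨fun q => (G (φ q.1, q.2) : Matrix (Fin n) (Fin n) ℂ).map (RCLike.map ℂ 𝕜), ?_⟩,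
    fun x t => ?_, fun q => isSelfAdjoint_map (G _).2, fun t z w => ?_⟩
  · refine Continuous.matrix_map ?_ (RCLike.map ℂ 𝕜).continuous
    exact continuous_subtype_val.comp (G.continuous.comp
      ((φ.continuous.comp continuous_fst).prodMk continuous_snd))
  · have hx : φ x ∈ X' := by
      change φ.symm (φ x) ∈ X
      rw [φ.symm_apply_apply]; exact x.2
    have h := hGF ⟨φ x, hx⟩ t
    have hjx : j ⟨φ x, hx⟩ = x := Subtype.ext (φ.symm_apply_apply _)
    simp only [ContinuousMap.coe_mk] at h ⊢
    rw [h]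
    simp only [hjx]
    ext a b
    exact map_map_complex _
  · have h := hG t
    rw [← ENNReal.coe_mul, lipSeminorm_le_coe_iff] at h
    replace h := h (φ z) (φ w)
    rw [φ.isometry.dist_eq, NNReal.coe_mul] at h
    refine le_trans ?_ h
    simp only [ContinuousMap.coe_mk]
    rw [← Matrix.map_sub _ (map_sub _)]
    exact l2_opNorm_map_of_complex_le _

/-! ### Paths of self-adjoint extensions and their spectral projections. -/

section Path

variable {𝕜 : Type*} [RCLike 𝕜] {n : ℕ}

/-- Used to see that taking spectral projections fixes values that are already projections. -/
theorem isGapProjection_self {E : Type*} [NormedAddCommGroup E] [InnerProductSpace 𝕜 E]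
    [CompleteSpace E] {Q : E →L[𝕜] E} (hQ : IsStarProjection Q) {γ : ℝ} (hγ : γ ≤ 1 / 2) :
    IsGapProjection γ Q Q := by
  refine ⟨hQ, rfl, fun v => ?_⟩
  have h5 : (1 / 2 : 𝕜) = ((1 / 2 : ℝ) : 𝕜) := by
    rw [RCLike.ofReal_div, RCLike.ofReal_one, RCLike.ofReal_ofNat]
  have e : (Q - (1 / 2 : 𝕜) • 1) * (2 • Q - 1) = (1 / 2 : 𝕜) • 1 := by
    have hQQ := hQ.isIdempotentElem.eq
    have h : (2 : ℕ) • Q = (2 : 𝕜) • Q := by rw [two_smul, two_smul]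
    rw [h, sub_mul, mul_sub, mul_smul_comm, hQQ, mul_one, smul_mul_assoc, one_mul, smul_sub,
      smul_smul, one_div_mul_cancel two_ne_zero, one_smul, two_smul]
    abel
  rw [← mul_apply_eq_comp, e, smul_apply, one_apply_eq_self, inner_smul_left, h5,
    RCLike.conj_ofReal, RCLike.re_ofReal_mul, inner_self_eq_norm_sq]
  gcongr

theorem IsGapProjection.mul_norm_matrix_sub_le {γ : ℝ} {a b P Q : Matrix (Fin n) (Fin n) 𝕜}
    (h : IsGapProjection γ (Matrix.toEuclideanCLM (𝕜 := 𝕜) a) (Matrix.toEuclideanCLM (𝕜 := 𝕜) P))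
    (k : IsGapProjection γ (Matrix.toEuclideanCLM (𝕜 := 𝕜) b) (Matrix.toEuclideanCLM (𝕜 := 𝕜) Q))
    (hγ : 0 ≤ γ) : γ * ‖P - Q‖ ≤ ‖a - b‖ := by
  rw [Matrix.cstar_norm_def, Matrix.cstar_norm_def, map_sub, map_sub]
  exact h.mul_norm_sub_le k hγ

variable {Z : Type*} [MetricSpace Z]

/-- The self-adjoint functions on `Z` that restrict to some `p s` on `X` and have Lipschitz seminorm
at most `K`. -/
def lipExtensions (X : Set Z) (p : C(unitInterval, C(X, Matrix (Fin n) (Fin n) 𝕜))) (K : ℝ≥0∞) :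
    Set C(Z, Matrix (Fin n) (Fin n) 𝕜) :=
  {f | (∀ z, IsSelfAdjoint (f z)) ∧ (∃ s, f.restrict X = p s) ∧ lipSeminorm f ≤ K}

variable {X : Set Z} {p : C(unitInterval, C(X, Matrix (Fin n) (Fin n) 𝕜))} {K : ℝ≥0∞}

theorem isStarProjection_apply {Y : Type*} [TopologicalSpace Y]
    {f : C(Y, Matrix (Fin n) (Fin n) 𝕜)} (hf : IsStarProjection f) (y : Y) :
    IsStarProjection (f y) :=
  ⟨DFunLike.congr_fun hf.isIdempotentElem.eq y, DFunLike.congr_fun hf.isSelfAdjoint.star_eq y⟩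

theorem isStarProjection_of_apply {Y : Type*} [TopologicalSpace Y]
    {f : C(Y, Matrix (Fin n) (Fin n) 𝕜)} (hf : ∀ y, IsStarProjection (f y)) :
    IsStarProjection f :=
  ⟨ContinuousMap.ext fun y => (hf y).isIdempotentElem.eq,
    ContinuousMap.ext fun y => (hf y).isSelfAdjoint.star_eq⟩

theorem joinedIn_lipExtensions_of_restrict_eq {f g : C(Z, Matrix (Fin n) (Fin n) 𝕜)}
    (hf : f ∈ lipExtensions X p K) (hg : g ∈ lipExtensions X p K)
    (h : f.restrict X = g.restrict X) : JoinedIn (lipExtensions X p K) f g := by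
  refine JoinedIn.ofLine (f := fun s : ℝ => ((1 - s : ℝ) : 𝕜) • f + (s : 𝕜) • g)
    (Continuous.continuousOn (by fun_prop)) (by ext1 z; simp) (by ext1 z; simp) ?_
  rintro _ ⟨s, ⟨hs0, hs1⟩, rfl⟩
  obtain ⟨r, hr⟩ := hf.2.1
  refine ⟨fun z => ?_, ⟨r, ?_⟩, lipSeminorm_le_iff.2 fun x y => ?_⟩
  · exact (IsSelfAdjoint.smul (RCLike.conj_ofReal (K := 𝕜) (1 - s)) (hf.1 z)).add
      (IsSelfAdjoint.smul (RCLike.conj_ofReal (K := 𝕜) s) (hg.1 z))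
  · ext1 x
    have hx : f x = g x := DFunLike.congr_fun h x
    have hrx : f x = p r x := DFunLike.congr_fun hr x
    simp only [ContinuousMap.restrict_apply, ContinuousMap.add_apply, ContinuousMap.smul_apply]
    rw [← hx, ← add_smul, ← hrx]
    simp
  · have e : (((1 - s : ℝ) : 𝕜) • f + (s : 𝕜) • g) x - (((1 - s : ℝ) : 𝕜) • f + (s : 𝕜) • g) y
        = ((1 - s : ℝ) : 𝕜) • (f x - f y) + (s : 𝕜) • (g x - g y) := by
      simp only [ContinuousMap.add_apply, ContinuousMap.smul_apply, smul_sub]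
      abel
    have hle : ‖((1 - s : ℝ) : 𝕜) • (f x - f y) + (s : 𝕜) • (g x - g y)‖
        ≤ (1 - s) * ‖f x - f y‖ + s * ‖g x - g y‖ := by
      refine (norm_add_le _ _).trans_eq ?_
      rw [norm_smul, norm_smul, RCLike.norm_ofReal, RCLike.norm_ofReal,
        abs_of_nonneg hs0, abs_of_nonneg (sub_nonneg.2 hs1)]
    rw [e]
    rcases le_total ‖f x - f y‖ ‖g x - g y‖ with hc | hc
    · refine le_trans ?_ (lipSeminorm_le_iff.1 hg.2.2 x y)
      rw [enorm_le_iff_norm_le]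
      nlinarith
    · refine le_trans ?_ (lipSeminorm_le_iff.1 hf.2.2 x y)
      rw [enorm_le_iff_norm_le]
      nlinarith

variable [CompactSpace Z]

/-- Replace each value along the path by its spectral projection. `K = ∞` is allowed when `ε = 0`.
-/
theorem exists_path_of_joinedIn (hp : ∀ t, IsStarProjection (p t))
    {q₀ q₁ : C(Z, Matrix (Fin n) (Fin n) 𝕜)} (hq₀ : IsStarProjection q₀)
    (hq₁ : IsStarProjection q₁) {ε : ℝ≥0} (hdense : ∀ z : Z, ∃ x ∈ X, dist z x ≤ ε)
    (hεK : ε * K < 1 / 2) (hJ : JoinedIn (lipExtensions X p K) q₀ q₁) :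
    ∃ q : Path q₀ q₁, (∀ t, IsStarProjection (q t)) ∧ (∀ t, ∃ s, (q t).restrict X = p s) ∧
      ∀ t, lipSeminorm (q t) ≤ (1 / 2 - ε * K)⁻¹ * K := by
  obtain ⟨f, hf⟩ := hJ
  have htop : ε * K ≠ ⊤ := ne_top_of_lt hεK
  set δ := (ε * K).toReal with hδ
  have hδK : ε * K = ENNReal.ofReal δ := (ENNReal.ofReal_toReal htop).symm
  have hhalf : (1 / 2 : ℝ≥0∞) = ENNReal.ofReal (1 / 2) := by
    rw [ENNReal.ofReal_div_of_pos two_pos]; simp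
  have hγ : 0 < 1 / 2 - δ := by
    rw [hδK, hhalf, ENNReal.ofReal_lt_ofReal_iff (by norm_num)] at hεK
    linarith
  have hγ' : 1 / 2 - δ ≤ 1 / 2 := sub_le_self _ ENNReal.toReal_nonneg
  have hex : ∀ (t : unitInterval) (z : Z), ∃ P : Matrix (Fin n) (Fin n) 𝕜, IsStarProjection P ∧
      IsGapProjection (1 / 2 - δ) (Matrix.toEuclideanCLM (𝕜 := 𝕜) (f t z))
        (Matrix.toEuclideanCLM (𝕜 := 𝕜) P) := by
    intro t z
    obtain ⟨hsa, ⟨s, hs⟩, hlip⟩ := hf t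
    obtain ⟨x, hx, hzx⟩ := hdense z
    refine exists_isGapProjection (p := f t x) (hsa z) ?_ ?_
    · have : f t x = p s ⟨x, hx⟩ := DFunLike.congr_fun hs ⟨x, hx⟩
      rw [this]
      exact isStarProjection_apply (hp s) _
    · have h := lipSeminorm_le_iff.1 hlip z x
      have h2 : edist z x ≤ ε := by
        rw [edist_dist, ← ENNReal.ofReal_coe_nnreal]
        exact ENNReal.ofReal_le_ofReal hzx
      rw [← toReal_enorm]
      refine ENNReal.toReal_mono htop (h.trans ?_)
      rw [mul_comm]
      gcongr
  choose P hP hPgap using hex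
  -- One estimate gives joint continuity, the Lipschitz bound in `z`, and through `huniq` the
  -- endpoints and restrictions.
  have hmul : ∀ t z t' z', ‖P t z - P t' z'‖ ≤ (1 / 2 - δ)⁻¹ * ‖f t z - f t' z'‖ := by
    intro t z t' z'
    rw [← div_eq_inv_mul, le_div_iff₀' hγ]
    exact (hPgap t z).mul_norm_matrix_sub_le (hPgap t' z') hγ.le
  have huniq : ∀ t z, IsStarProjection (f t z) → P t z = f t z := by
    intro t z h
    have h1 := (hPgap t z).mul_norm_matrix_sub_le
      (isGapProjection_self (h.map (Matrix.toEuclideanCLM (𝕜 := 𝕜))) hγ') hγ.le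
    rw [sub_self, norm_zero] at h1
    have h2 : ‖P t z - f t z‖ ≤ 0 := by
      by_contra! hc
      nlinarith
    exact sub_eq_zero.1 (norm_le_zero_iff.1 h2)
  have hcont : Continuous fun y : unitInterval × Z => P y.1 y.2 := by
    have hfc : Continuous fun y : unitInterval × Z => f y.1 y.2 := by fun_prop
    rw [continuous_iff_continuousAt]
    intro y
    rw [ContinuousAt, tendsto_iff_norm_sub_tendsto_zero]
    have h0 := (tendsto_iff_norm_sub_tendsto_zero.1 (hfc.tendsto y)).const_mul (1 / 2 - δ)⁻¹
    rw [mul_zero] at h0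
    exact squeeze_zero (fun _ => norm_nonneg _) (fun _ => hmul _ _ _ _) h0
  let Pc : C(unitInterval, C(Z, Matrix (Fin n) (Fin n) 𝕜)) := ContinuousMap.curry ⟨_, hcont⟩
  have hPc : ∀ t z, Pc t z = P t z := fun t z => rfl
  refine ⟨⟨Pc, ?_, ?_⟩, fun t => isStarProjection_of_apply (hP t), fun t => ?_, fun t => ?_⟩
  · ext1 z
    have : f 0 z = q₀ z := by rw [f.source]
    change P 0 z = q₀ z
    rw [huniq 0 z (this ▸ isStarProjection_apply hq₀ z), this]
  · ext1 z
    have : f 1 z = q₁ z := by rw [f.target]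
    change P 1 z = q₁ z
    rw [huniq 1 z (this ▸ isStarProjection_apply hq₁ z), this]
  · obtain ⟨-, ⟨s, hs⟩, -⟩ := hf t
    refine ⟨s, ?_⟩
    ext1 x
    have : f t x = p s x := DFunLike.congr_fun hs x
    change P t x = p s x
    rw [huniq t x (this ▸ isStarProjection_apply (hp s) x), this]
  · rw [lipSeminorm_le_iff]
    intro z w
    have h1 : (1 / 2 - ε * K)⁻¹ = ENNReal.ofReal (1 / 2 - δ)⁻¹ := by
      rw [hδK, hhalf, ← ENNReal.ofReal_sub _ ENNReal.toReal_nonneg, ENNReal.ofReal_inv_of_pos hγ]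
    have h2 := ENNReal.ofReal_le_ofReal (hmul t z t w)
    rw [ENNReal.ofReal_mul (by positivity), ofReal_norm, ofReal_norm, ← h1] at h2
    refine h2.trans ?_
    rw [mul_assoc]
    gcongr
    exact lipSeminorm_le_iff.1 (hf t).2.2 z w

theorem IsExtensionConstant.exists_path {c : ℝ≥0} (hc : IsExtensionConstant n c) (hX : IsClosed X)
    (hp : ∀ t, IsStarProjection (p t)) {q₀ q₁ : C(Z, Matrix (Fin n) (Fin n) 𝕜)}
    (hq₀ : IsStarProjection q₀) (hq₁ : IsStarProjection q₁)
    (hq₀p : q₀.restrict X = p 0) (hq₁p : q₁.restrict X = p 1)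
    {N : ℝ≥0} (hN : ∀ t, lipSeminorm (p t) ≤ N) {ε : ℝ≥0}
    (hdense : ∀ z : Z, ∃ x ∈ X, dist z x ≤ ε) (hεK : ε * K < 1 / 2)
    (hcN : ((c * N : ℝ≥0) : ℝ≥0∞) ≤ K) (hK₀ : lipSeminorm q₀ ≤ K) (hK₁ : lipSeminorm q₁ ≤ K) :
    ∃ q : Path q₀ q₁, (∀ t, IsStarProjection (q t)) ∧ (∀ t, ∃ s, (q t).restrict X = p s) ∧
      ∀ t, lipSeminorm (q t) ≤ (1 / 2 - ε * K)⁻¹ * K := by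
  have : CompactSpace X := isCompact_iff_compactSpace.1 hX.isCompact
  obtain ⟨G, hGF, hGs, hG⟩ := hc.exists_extension hX
    (⟨fun y => p y.2 y.1, by fun_prop⟩ : C(X × unitInterval, Matrix (Fin n) (Fin n) 𝕜))
    (fun y => (isStarProjection_apply (hp y.2) y.1).isSelfAdjoint)
    (fun t => lipSeminorm_le_coe_iff.1 (hN t))
  let g : C(unitInterval, C(Z, Matrix (Fin n) (Fin n) 𝕜)) :=
    ContinuousMap.curry ⟨fun y => G (y.2, y.1), by fun_prop⟩
  have hgp : ∀ t, (g t).restrict X = p t := fun t => ContinuousMap.ext fun x => hGF x t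
  have hg : ∀ t, g t ∈ lipExtensions X p K := fun t =>
    ⟨fun z => hGs (z, t), ⟨t, hgp t⟩, (lipSeminorm_le_coe_iff.2 fun z w => by
      rw [NNReal.coe_mul]; exact hG t z w).trans hcN⟩
  have hJ : JoinedIn (lipExtensions X p K) (g 0) (g 1) := ⟨⟨g, rfl, rfl⟩, hg⟩
  refine exists_path_of_joinedIn hp hq₀ hq₁ hdense hεK (JoinedIn.trans ?_ (hJ.trans ?_))
  · exact joinedIn_lipExtensions_of_restrict_eq
      ⟨fun z => (isStarProjection_apply hq₀ z).isSelfAdjoint, ⟨0, hq₀p⟩, hK₀⟩ (hg 0)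
      (hq₀p.trans (hgp 0).symm)
  · exact joinedIn_lipExtensions_of_restrict_eq (hg 1)
      ⟨fun z => (isStarProjection_apply hq₁ z).isSelfAdjoint, ⟨1, hq₁p⟩, hK₁⟩
      ((hgp 1).trans hq₁p.symm)

end Path

/-! ### Near-optimal constants and the choice of `K`. -/

theorem exists_isExtensionConstant_lt {n : ℕ} {b : ℝ≥0} (hb : extensionConstant n < b) :
    ∃ c, IsExtensionConstant n c ∧ c < b :=
  exists_lt_of_csInf_lt (exists_isExtensionConstant n) hb

/-- Near-optimal extension constants, after scaling by `N`. -/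
theorem exists_isExtensionConstant_mul_le {n : ℕ} {N : ℝ≥0} {b : ℝ≥0∞}
    (hb : ((extensionConstant n * N : ℝ≥0) : ℝ≥0∞) < b) :
    ∃ c, IsExtensionConstant n c ∧ ((c * N : ℝ≥0) : ℝ≥0∞) ≤ b := by
  obtain ⟨d, hd, hdb⟩ := ENNReal.lt_iff_exists_nnreal_btwn.1 hb
  rw [ENNReal.coe_lt_coe] at hd
  rcases eq_or_ne N 0 with rfl | hN
  · obtain ⟨c, hc⟩ := exists_isExtensionConstant n
    exact ⟨c, hc, by simp⟩
  · have hN' : 0 < N := pos_iff_ne_zero.2 hN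
    obtain ⟨c, hc, hcd⟩ := exists_isExtensionConstant_lt ((lt_div_iff₀ hN').2 hd)
    refine ⟨c, hc, le_trans ?_ hdb.le⟩
    rw [ENNReal.coe_le_coe]
    exact ((lt_div_iff₀ hN').1 hcd).le

theorem isExtensionConstant_zero (c : ℝ≥0) : IsExtensionConstant 0 c := by
  intro Z _ _ X _ T _ _ F N _
  have h : ∀ v : SAMatrix 0, ‖v‖ₑ = 0 := fun v => by
    rw [Subsingleton.elim v 0, ← ofReal_norm, norm_zero, ENNReal.ofReal_zero]
  refine ⟨0, fun _ _ => Subsingleton.elim _ _, fun t => ?_, ?_⟩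
  · rw [lipSeminorm_le_iff]
    intro x y
    rw [h]
    exact zero_le
  · simp [supNorm, h]

end ProjectionExtension

theorem theorem6p4 {𝕜 : Type*} [RCLike 𝕜] {Z : Type*} [MetricSpace Z] [CompactSpace Z]
    (X : Set Z) (hX : IsClosed X) (n : ℕ)
    (p : C(unitInterval, C(X, Matrix (Fin n) (Fin n) 𝕜)))
    (hp : ∀ t, IsStarProjection (p t))
    (q₀ q₁ : C(Z, Matrix (Fin n) (Fin n) 𝕜))
    (hq₀ : IsStarProjection q₀) (hq₁ : IsStarProjection q₁)
    (hq₀p : q₀.restrict X = p 0) (hq₁p : q₁.restrict X = p 1)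
    (N : ℝ≥0) (hN : ∀ t, ProjectionExtension.lipSeminorm (p t) ≤ N)
    (N' : ℝ≥0∞)
    (hN' : N' = max (ProjectionExtension.lipSeminorm q₀) (ProjectionExtension.lipSeminorm q₁))
    (ε : ℝ≥0) (hdense : ∀ z : Z, ∃ x ∈ X, dist z x ≤ ε)
    (hεN : ε * ProjectionExtension.extensionConstant n * N < 1 / 14)
    (hεN' : ε * N' < 1 / 2) :
    ∃ q : Path q₀ q₁,
      (∀ t, IsStarProjection (q t)) ∧
      (∀ t, ∃ s, (q t).restrict X = p s) ∧
      (∀ t, ProjectionExtension.lipSeminorm (q t) ≤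
        (1 / 2 - ε * N')⁻¹ * max ((7 * ProjectionExtension.extensionConstant n * N : ℝ≥0) : ℝ≥0∞) N') := by
  have h₀ : ProjectionExtension.lipSeminorm q₀ ≤ N' := hN' ▸ le_max_left _ _
  have h₁ : ProjectionExtension.lipSeminorm q₁ ≤ N' := hN' ▸ le_max_right _ _
  set l := ProjectionExtension.extensionConstant n
  rcases lt_or_ge ((l * N : ℝ≥0) : ℝ≥0∞) N' with hlt | hge
  · obtain ⟨c, hc, hcN⟩ := ProjectionExtension.exists_isExtensionConstant_mul_le hlt
    obtain ⟨q, hq, hqp, hqL⟩ :=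
      hc.exists_path hX hp hq₀ hq₁ hq₀p hq₁p hN hdense hεN' hcN h₀ h₁
    refine ⟨q, hq, hqp, fun t => (hqL t).trans ?_⟩
    gcongr
    exact le_max_right _ _
  -- Here `K = 2 λ_n N`, and the hypothesis with `1/14` is doubled.
  have hK : ε * ((2 * (l * N) : ℝ≥0) : ℝ≥0∞) ≤ 1 / 7 := by
    have h : ε * (2 * (l * N)) ≤ 1 / 7 := by
      rw [← NNReal.coe_lt_coe] at hεN
      rw [← NNReal.coe_le_coe]
      push_cast at hεN ⊢
      linarith
    have h7 : (1 / 7 : ℝ≥0∞) = ((1 / 7 : ℝ≥0) : ℝ≥0∞) := by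
      rw [ENNReal.coe_div (by norm_num)]; norm_num
    rw [h7, ← ENNReal.coe_mul]
    exact ENNReal.coe_le_coe.2 h
  have hK' : ε * ((2 * (l * N) : ℝ≥0) : ℝ≥0∞) < 1 / 2 :=
    hK.trans_lt (by
      rw [one_div, one_div]
      exact ENNReal.inv_lt_inv.2 (by norm_num))
  have hc : ∃ c, ProjectionExtension.IsExtensionConstant n c ∧
      ((c * N : ℝ≥0) : ℝ≥0∞) ≤ ((2 * (l * N) : ℝ≥0) : ℝ≥0∞) := by
    -- Strict room below `2 λ_n N` requires `λ_n N > 0`, so `n = 0` and `N = 0` are treated apart.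
    rcases eq_or_ne n 0 with rfl | hn
    · exact ⟨0, ProjectionExtension.isExtensionConstant_zero 0, by simp⟩
    rcases eq_or_ne N 0 with rfl | hN0
    · obtain ⟨c, hc⟩ := ProjectionExtension.exists_isExtensionConstant n
      exact ⟨c, hc, by simp⟩
    refine ProjectionExtension.exists_isExtensionConstant_mul_le (ENNReal.coe_lt_coe.2 ?_)
    have : 0 < l * N :=
      mul_pos (one_pos.trans_le (ProjectionExtension.one_le_extensionConstant hn)) (pos_iff_ne_zero.2 hN0)
    rw [two_mul]
    exact lt_add_of_pos_left _ this
  have hN'K : N' ≤ ((2 * (l * N) : ℝ≥0) : ℝ≥0∞) := by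
    refine hge.trans (ENNReal.coe_le_coe.2 ?_)
    rw [two_mul]
    exact le_add_self
  obtain ⟨c, hc, hcN⟩ := hc
  obtain ⟨q, hq, hqp, hqL⟩ := hc.exists_path hX hp hq₀ hq₁ hq₀p hq₁p hN hdense hK' hcN
    (h₀.trans hN'K) (h₁.trans hN'K)
  refine ⟨q, hq, hqp, fun t => (hqL t).trans ?_⟩
  -- The gap is at least `1/2 - 1/7 ≥ 1/7`, so the bound is `7 * 2 λ_n N = (1/2)⁻¹ * 7 λ_n N`.
  have h17 : (1 / 7 : ℝ≥0∞) ≤ 1 / 2 - ε * ((2 * (l * N) : ℝ≥0) : ℝ≥0∞) := by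
    refine le_trans ?_ (tsub_le_tsub_left hK _)
    refine ENNReal.le_sub_of_add_le_right (by norm_num) ?_
    have h4 : (1 / 7 + 1 / 7 : ℝ≥0∞) ≤ 1 / 4 + 1 / 4 := by
      gcongr <;> norm_num
    refine h4.trans_eq ?_
    rw [← ENNReal.add_halves (1 / 2), one_div, one_div, ENNReal.div_eq_inv_mul,
      ← ENNReal.mul_inv (by simp) (by simp)]
    norm_num
  calc (1 / 2 - ε * ((2 * (l * N) : ℝ≥0) : ℝ≥0∞))⁻¹ * ((2 * (l * N) : ℝ≥0) : ℝ≥0∞)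
      ≤ (1 / 7)⁻¹ * ((2 * (l * N) : ℝ≥0) : ℝ≥0∞) := by gcongr
    _ = (1 / 2)⁻¹ * ((7 * l * N : ℝ≥0) : ℝ≥0∞) := by
        simp only [one_div, inv_inv]
        push_cast
        ring
    _ ≤ _ := by
        gcongr
        · exact tsub_le_self
        · exact le_max_left _ _
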